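/- Let $K$ be a field and let $r_1>1$, $x_1\ge 1$ be integers; put $d=r_1+x_1-1$. For integers $a,b$ write $(a^{x_1},b^{r_1-1})\in\mathbb{Z}^d$ for the vector whose first $x_1$ entries are $a$ and whose last $r_1-1$ entries are $b$. Define points of $\mathbb{Z}^d$ by $\mathbf{a}'_{r_1+1}=((-1)^{x_1},(-x_1)^{r_1-1})$, $\mathbf{a}'_{r_1+2}=(0^{x_1},(-1)^{r_1-1})$, $\mathbf{a}'_{r_1+3}=\mathbf{0}$, $\mathbf{a}'_i=(r_1-i+1)\mathbf{a}'_{r_1+1}+\mathbf{a}'_{r_1+2}$ for $1\le i\le r_1$, and $\mathbf{b}'_j=\mathbf{e}_{d-j+1}$ for $1\le j\le d$; let $\mathbf{a}_i=(\mathbf{a}'_i,1)$ and $\mathbf{b}_j=(\mathbf{b}'_j,1)$ in $\mathbb{Z}^{d+1}$. The toric ideal $I_{\mathcal{A}}$ is the kernel of the $K$-algebra homomorphism $$K[z_1,\dots,z_{r_1+3},y_1,\dots,y_d]\to K[t_1^{\pm1},\dots,t_{d+1}^{\pm1}],\qquad z_i\mapsto \mathbf{t}^{\mathbf{a}_i},\quad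 y_j\mapsto\mathbf{t}^{\mathbf{b}_j}.$$ Let $<_{lex}$ be the lexicographic order with $z_1>\cdots>z_{r_1+3}>y_1>\cdots>y_d$. Let $B$ be the set of pairs $(i,j)$ of integers with $j-i\ge 2$, $1\le i\le r_1$, $j\le r_1+3$, $j\ne r_1+1$ and $(i,j)\neq(r_1,r_1+2)$. For $(i,j)\in B$ let $$(k,\ell)=\begin{cases}\left(\lfloor\frac{i+j}{2}\rfloor,\lceil\frac{i+j}{2}\rceil\right)& \text{if } j<r_1+1,\\ \left(\lfloor\frac{i+j-1}{2}\rfloor,\lceil\frac{i+j-1}{2}\rceil\right)& \text{if } j=r_1+2,\\ (i+1,\,r_1+1)& \text{if } j=r_1+3,\ i\ne r_1,\\ (r_1+1,\,r_1+2)& \text{if } j=r_1+3,\ i=r_1.\end{cases}$$ Let $\mathcal{G}$ consist of the following binomials: 1. $z_iz_j-z_kz_\ell$ for $(i,j)\in B$; 2. $z_{k+1}\prod_{\ell=1}^{r_1-1}y_\ell-z_{r_1+1}^{r_1-k}z_{r_1+3}^{k}$ for $0\le k\le r_1-1$; 3. if $x_1\ge r_1-2$: $z_{r_1-k}\prod_{\ell=r_1}^{d}y_\ell-z_{r_1}^{k}z_{r_1+2}^{x_1+1-k}$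 for $0\le k\le r_1-1$; if $x_1<r_1-2$: instead $z_{r_1-k}\prod_{\ell=r_1}^{d}y_\ell-w_k$ for $0\le k\le r_1-1$, where $$w_k=\begin{cases}z_{r_1}^{k}z_{r_1+2}^{x_1+1-k}&\text{if } 0\le k\le x_1+1,\\ z_{r_1-1}^{k-x_1-1}z_{r_1}^{2x_1+2-k}&\text{if } x_1+2\le k\le 2x_1+2,\\ z_{r_1-q}^{s}\,z_{r_1-q+1}^{x_1+1-s}&\text{if } k>2x_1+2,\ k=q(x_1+1)+s,\ 0\le s\le x_1;\end{cases}$$ 4. $z_{r_1+2}\prod_{\ell=1}^{r_1-1}y_\ell-z_{r_1+3}^{r_1}$; 5. $z_{r_1+1}\prod_{\ell=r_1}^{d}y_\ell-z_{r_1+2}^{x_1}z_{r_1+3}$. Then $\mathcal{G}$ is a Gröbner basis of $I_{\mathcal{A}}$ with respect to $<_{lex}$: it is a finite subset of $I_{\mathcal{A}}$ and its leading terms generate the initial ideal of $I_{\mathcal{A}}$. All elements of $\mathcal{G}$ are nonzero with squarefree leading term. In particular the lexicographic initial ideal of $I_{\mathcal{A}}$ is generated by squarefree monomials. -/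

import Mathlib

open MvPolynomial

/-! Throughout, `r` and `x` are the numbers `r₁` and `x₁`: the weight vector is
`q = (r^x, (1 + r x)^(r - 1))`. All indices below are 1-based, as in ordinary mathematical notation:
`z_1, …, z_{r+3}` and `y_1, …, y_d`. -/

namespace TwoSupported

/-- The dimension `d = x + (r - 1)` of the simplex (used for `r > 1`). -/
def dim (r x : ℕ) : ℕ := r + x - 1

/-- `((-1)^x, (-x)^(r-1))`. -/
def u (r x : ℕ) : Fin (dim r x) → ℤ := fun c => if c.val < x then -1 else -(x : ℤ)

/-- `(0^x, (-1)^(r-1))`. -/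
def v (r x : ℕ) : Fin (dim r x) → ℤ := fun c => if c.val < x then 0 else -1

/-- The point `a'_i`, for `1 ≤ i ≤ r + 3`. -/
def aPt (r x i : ℕ) : Fin (dim r x) → ℤ :=
  if i ≤ r then ((r : ℤ) - i + 1) • u r x + v r x
  else if i = r + 1 then u r x
  else if i = r + 2 then v r x
  else 0

/-- The point `b'_j = e_{d-j+1}`, for `1 ≤ j ≤ d`. The coordinate `e_{d-j+1}` is the one whose
0-based position `c` satisfies `c + j = d`. -/
def bPt (r x j : ℕ) : Fin (dim r x) → ℤ := fun c => if c.val + j = dim r x then 1 else 0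

/-- The homogenization `(p, 1)` of a point `p`. -/
def homogenize {d : ℕ} (p : Fin d → ℤ) : Fin (d + 1) → ℤ := Fin.snoc (α := fun _ => ℤ) p 1

/-- The index set of the variables. As a linear order it is
`z_1, …, z_{r+3}, y_1, …, y_d`, listed increasingly; in `MonomialOrder.lex` a smaller
index is a larger variable, so this gives `z_1 > ⋯ > z_{r+3} > y_1 > ⋯ > y_d`. -/
abbrev Var (r x : ℕ) : Type := Lex (Fin (r + 3) ⊕ Fin (dim r x))

/-- The column of the homogenized point configuration belonging to each variable:
`a_i = (a'_i, 1)` for `z_i` and `b_j = (b'_j, 1)` for `y_j`. -/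
def config (r x : ℕ) (w : Var r x) : Fin (dim r x + 1) → ℤ :=
  match ofLex w with
  | Sum.inl i => homogenize (aPt r x (i.val + 1))
  | Sum.inr j => homogenize (bPt r x (j.val + 1))

noncomputable section

variable (K : Type*) [Field K] (r x : ℕ)

/-- The map `π` to the Laurent polynomial ring `K[t_1^{±1}, …, t_{d+1}^{±1}]` (the group algebra of
`ℤ^{d+1}`), sending each variable to the Laurent monomial `t^a` of its column `a`. -/
def toricMap : MvPolynomial (Var r x) K →ₐ[K] AddMonoidAlgebra K (Fin (dim r x + 1) → ℤ) :=
  MvPolynomial.aeval fun w => AddMonoidAlgebra.single (config r x w) (1 : K)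

/-- The toric ideal of the homogenized configuration. -/
def toricIdeal : Ideal (MvPolynomial (Var r x) K) := RingHom.ker (toricMap K r x)

/-- The variable `z_i`, for `1 ≤ i ≤ r + 3` (zero outside of this range, never used there). -/
def z (i : ℕ) : MvPolynomial (Var r x) K :=
  if h : 1 ≤ i ∧ i ≤ r + 3 then X (toLex (Sum.inl ⟨i - 1, by omega⟩)) else 0

/-- The variable `y_j`, for `1 ≤ j ≤ d` (zero outside of this range, never used there). -/
def y (j : ℕ) : MvPolynomial (Var r x) K :=
  if h : 1 ≤ j ∧ j ≤ dim r x then X (toLex (Sum.inr ⟨j - 1, by omega⟩)) else 0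

/-- The index set `B` of the quadrics. -/
def B : Set (ℕ × ℕ) :=
  {p | p.1 + 2 ≤ p.2 ∧ 1 ≤ p.1 ∧ p.1 ≤ r ∧ p.2 ≤ r + 3 ∧ p.2 ≠ r + 1 ∧ p ≠ (r, r + 2)}

/-- The pair `(k, ℓ)` attached to `(i, j) ∈ B`. Natural division `n / 2` is `⌊n/2⌋`, and
`(n + 1) / 2` is `⌈n/2⌉`; in the second case `n = i + j - 1`. -/
def kl (p : ℕ × ℕ) : ℕ × ℕ :=
  if p.2 < r + 1 then ((p.1 + p.2) / 2, (p.1 + p.2 + 1) / 2)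
  else if p.2 = r + 2 then ((p.1 + p.2 - 1) / 2, (p.1 + p.2) / 2)
  else if p.1 ≠ r then (p.1 + 1, r + 1)
  else (r + 1, r + 2)

/-- The product `y_1 ⋯ y_{r-1}`. -/
def prodLow : MvPolynomial (Var r x) K := ∏ l ∈ Finset.Icc 1 (r - 1), y K r x l

/-- The product `y_r ⋯ y_d`. -/
def prodHigh : MvPolynomial (Var r x) K := ∏ l ∈ Finset.Icc r (dim r x), y K r x l

/-- The quadrics `z_i z_j - z_k z_ℓ`, `(i, j) ∈ B`. -/
def family1 : Set (MvPolynomial (Var r x) K) :=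
  {f | ∃ p ∈ B r, f = z K r x p.1 * z K r x p.2 - z K r x (kl r p).1 * z K r x (kl r p).2}

/-- `z_{k+1} y_1 ⋯ y_{r-1} - z_{r+1}^{r-k} z_{r+3}^k`, `0 ≤ k ≤ r - 1`. -/
def family2 : Set (MvPolynomial (Var r x) K) :=
  {f | ∃ k : ℕ, k ≤ r - 1 ∧
    f = z K r x (k + 1) * prodLow K r x - z K r x (r + 1) ^ (r - k) * z K r x (r + 3) ^ k}

/-- `z_{r-k} y_r ⋯ y_d - z_r^k z_{r+2}^{x+1-k}`, `0 ≤ k ≤ r - 1`; used when `x ≥ r - 2`. -/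
def family3 : Set (MvPolynomial (Var r x) K) :=
  {f | ∃ k : ℕ, k ≤ r - 1 ∧
    f = z K r x (r - k) * prodHigh K r x - z K r x r ^ k * z K r x (r + 2) ^ (x + 1 - k)}

/-- The second monomial of the `k`-th binomial of the family that replaces `family3` when
`x < r - 2`. For `k > 2 x + 2`, where the exponent `2 x + 2 - k` is negative, it is
`z_{r-q}^s z_{r-q+1}^{x+1-s}` with `k = q (x + 1) + s`, `0 ≤ s ≤ x` (the same formula gives
the second case for `q = 1`). -/
def tail3star (k : ℕ) : MvPolynomial (Var r x) K :=
  if k ≤ x + 1 then z K r x r ^ k * z K r x (r + 2) ^ (x + 1 - k)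
  else if k ≤ 2 * x + 2 then z K r x (r - 1) ^ (k - x - 1) * z K r x r ^ (2 * x + 2 - k)
  else z K r x (r - k / (x + 1)) ^ (k % (x + 1)) *
    z K r x (r - k / (x + 1) + 1) ^ (x + 1 - k % (x + 1))

/-- The family replacing `family3` when `x < r - 2`. -/
def family3star : Set (MvPolynomial (Var r x) K) :=
  {f | ∃ k : ℕ, k ≤ r - 1 ∧ f = z K r x (r - k) * prodHigh K r x - tail3star K r x k}

/-- `z_{r+2} y_1 ⋯ y_{r-1} - z_{r+3}^r`. -/
def binomial4 : MvPolynomial (Var r x) K :=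
  z K r x (r + 2) * prodLow K r x - z K r x (r + 3) ^ r

/-- `z_{r+1} y_r ⋯ y_d - z_{r+2}^x z_{r+3}`. -/
def binomial5 : MvPolynomial (Var r x) K :=
  z K r x (r + 1) * prodHigh K r x - z K r x (r + 2) ^ x * z K r x (r + 3)

open Classical in
/-- The set of binomials `𝒢`; the condition `r ≤ x + 2` is `x ≥ r - 2`. -/
def basis : Set (MvPolynomial (Var r x) K) :=
  family1 K r x ∪ family2 K r x ∪ (if r ≤ x + 2 then family3 K r x else family3star K r x) ∪
    {binomial4 K r x, binomial5 K r x}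

end

noncomputable section

variable {σ : Type*} {K : Type*} [Field K]

/-- The ideal generated by the leading terms of the elements of a set; for an ideal `I` this is
the initial ideal of `I`. -/
def initialIdeal (m : MonomialOrder σ) (S : Set (MvPolynomial σ K)) : Ideal (MvPolynomial σ K) :=
  Ideal.span (m.leadingTerm '' S)

/-- `G` is a Gröbner basis of `I`: a finite subset of `I` whose leading terms generate the initial
ideal of `I`. -/
def IsGroebnerBasis (m : MonomialOrder σ) (G : Set (MvPolynomial σ K))
    (I : Ideal (MvPolynomial σ K)) : Prop :=
  G.Finite ∧ G ⊆ (I : Set (MvPolynomial σ K)) ∧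
    initialIdeal m G = initialIdeal m (I : Set (MvPolynomial σ K))

/-- An ideal generated by squarefree monomials. -/
def IsSquarefreeMonomialIdeal (J : Ideal (MvPolynomial σ K)) : Prop :=
  ∃ S : Set (σ →₀ ℕ), (∀ s ∈ S, ∀ w, s w ≤ 1) ∧
    J = Ideal.span ((fun s => monomial s (1 : K)) '' S)

end

end TwoSupported

/-! The binomials of `𝒢` lie in the toric ideal and have the expected squarefree leading monomials,
so everything reduces to one statement: distinct standard monomials (those not divisible by a
leading monomial) have distinct images under the toric map. That this suffices is
`initialIdeal_eq_initialIdeal_ker`: the leading monomial of an element `f` of the ideal has the same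
image as a smaller monomial of `f`, hence as a smaller standard monomial, and so it cannot be
standard.

The image of a monomial `z^α y^β` is recorded by its weight in `ℤ^{d+1}`. Writing
`∑ α_i a'_i = a u + b v` with `a, b ≥ 0`, the weight has coordinates `β_j - a` on the first `x`
coordinates and `β_j - x a - b` on the last `r - 1`. If `a > 0`, then some variable among
`z_1, …, z_{r+1}` divides the monomial, and standardness with respect to the leading monomials
`z_i y_r ⋯ y_d` makes the minimum of the `β_j` over the first block equal to `0`. Hence `a` is
`max(0, -μ)`, where `μ` is the smallest of the first `x` coordinates (`uSum_le`). In the same way the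
leading monomials `z_i y_1 ⋯ y_{r-1}` determine `b` (`vSum_le`), and then all `β_j` and the degree
of `z^α` are known.

It remains to recover `α` from `a`, `b` and the degree (`z_exponents_eq`). In the basis `u, v` the
points `a'_i` are `(c, 1)` for `0 ≤ c ≤ r`, together with `(1, 0)` and `(0, 0)`, and the quadrics
allow only the supports contained in a triangle `(1, 0), (c, 1), (c + 1, 1)` or in
`(0, 0), (1, 0), (0, 1)`. These triangles are unimodular and triangulate the polygon. On the line
of the points `(c, 1)` this is the elementary fact `eq_of_consecutive`. -/

open MvPolynomial

namespace TwoSupported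

/-! ### Gröbner bases of toric ideals -/

section Toric

open scoped MonomialOrder

variable {σ M K : Type*} [AddCommMonoid M] [Field K] (m : MonomialOrder σ) (a : σ → M)

/-- A toric map sends the monomial of an exponent to the Laurent monomial of its weight. -/
lemma aeval_single_monomial (s : σ →₀ ℕ) (c : K) :
    aeval (fun w => AddMonoidAlgebra.single (a w) (1 : K)) (monomial s c) =
      AddMonoidAlgebra.single (Finsupp.weight a s) c := by
  rw [aeval_monomial]
  have h : (s.prod fun i k => (AddMonoidAlgebra.single (a i) (1 : K)) ^ k) =
      AddMonoidAlgebra.single (Finsupp.weight a s) (1 : K) := by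
    induction s using Finsupp.induction_linear with
    | zero => simp [AddMonoidAlgebra.one_def]
    | add f g hf hg =>
      rw [Finsupp.prod_add_index' (by simp) (fun i b₁ b₂ => pow_add _ _ _), hf, hg,
        AddMonoidAlgebra.single_mul_single, map_add, one_mul]
    | single i n => simp [AddMonoidAlgebra.single_pow, Finsupp.weight_single]
  rw [h]
  simp [AddMonoidAlgebra.single_mul_single]

variable {m} in
lemma degree_monomial_sub_monomial {s t : σ →₀ ℕ} (h : t ≺[m] s) :
    m.degree (monomial s (1 : K) - monomial t 1) = s := by
  classical
  have hs : m.degree (monomial s (1 : K)) = s := by simp [m.degree_monomial]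
  rw [m.degree_sub_of_lt, hs]
  rw [hs]
  simpa [m.degree_monomial] using h

variable {m} in
lemma leadingTerm_monomial_sub_monomial {s t : σ →₀ ℕ} (h : t ≺[m] s) :
    m.leadingTerm (monomial s (1 : K) - monomial t 1) = monomial s 1 := by
  classical
  have hs : m.degree (monomial s (1 : K)) = s := by simp [m.degree_monomial]
  rw [MonomialOrder.leadingTerm, degree_monomial_sub_monomial h, m.leadingCoeff_sub_of_lt,
    m.leadingCoeff_monomial]
  rw [hs]
  simpa [m.degree_monomial] using h

variable {m} in
lemma monomial_sub_monomial_ne_zero {s t : σ →₀ ℕ} (h : t ≺[m] s) :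
    (monomial s (1 : K) - monomial t 1) ≠ 0 := by
  rw [Ne, ← m.leadingTerm_eq_zero_iff, leadingTerm_monomial_sub_monomial h]
  simp

/-- An element of a toric ideal has, besides its leading monomial, another monomial of the same
weight: otherwise the leading term survives under the toric map. -/
lemma exists_lt_degree_weight_eq {f : MvPolynomial σ K} (hf : f ≠ 0)
    (hker : aeval (fun w => AddMonoidAlgebra.single (a w) (1 : K)) f = 0) :
    ∃ t, t ≺[m] m.degree f ∧ Finsupp.weight a t = Finsupp.weight a (m.degree f) := by
  classical
  by_contra! hne
  have hsum : aeval (fun w => AddMonoidAlgebra.single (a w) (1 : K)) f =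
      ∑ t ∈ f.support, AddMonoidAlgebra.single (Finsupp.weight a t) (coeff t f) := by
    conv_lhs => rw [f.as_sum, map_sum]
    exact Finset.sum_congr rfl fun t _ => aeval_single_monomial a t _
  rw [hsum] at hker
  have h0 := congrArg (fun p => AddMonoidAlgebra.coeff p (Finsupp.weight a (m.degree f))) hker
  simp only [AddMonoidAlgebra.coeff_sum, Finsupp.finsetSum_apply, AddMonoidAlgebra.coeff_single,
    AddMonoidAlgebra.coeff_zero, Finsupp.coe_zero, Pi.zero_apply] at h0
  rw [Finset.sum_eq_single (m.degree f)] at h0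
  · rw [Finsupp.single_eq_same] at h0
    exact m.coeff_degree_ne_zero_iff.2 hf h0
  · intro t ht htne
    refine Finsupp.single_eq_of_ne fun h => hne t ?_ h.symm
    exact lt_of_le_of_ne (m.le_degree ht) fun h => htne (m.toSyn.injective h)
  · intro h
    exact absurd (m.degree_mem_support hf) h

variable {a} in
/-- Replacing a multiple of a leading monomial by the same multiple of the trailing one lowers an
exponent and keeps its weight, so every exponent can be lowered to a standard one. -/
lemma exists_standard_weight_eq {G : Set (MvPolynomial σ K)}
    (hG : ∀ g ∈ G, ∃ s t, g = monomial s 1 - monomial t 1 ∧ t ≺[m] s ∧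
      Finsupp.weight a s = Finsupp.weight a t) (u : σ →₀ ℕ) :
    ∃ t, t ≼[m] u ∧ Finsupp.weight a t = Finsupp.weight a u ∧ ∀ g ∈ G, ¬ m.degree g ≤ t := by
  induction h : m.toSyn u using WellFoundedLT.induction generalizing u with
  | ind n ih =>
    subst h
    by_cases hu : ∀ g ∈ G, ¬ m.degree g ≤ u
    · exact ⟨u, le_rfl, rfl, hu⟩
    push Not at hu
    obtain ⟨g, hg, hgu⟩ := hu
    obtain ⟨s, t, rfl, hlt, hw⟩ := hG g hg
    rw [degree_monomial_sub_monomial hlt] at hgu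
    obtain ⟨v, rfl⟩ := exists_add_of_le hgu
    have hlt' : t + v ≺[m] s + v := by
      rw [map_add, map_add]
      exact add_lt_add_left hlt _
    obtain ⟨t', h1, h2, h3⟩ := ih _ hlt' (t + v) rfl
    exact ⟨t', h1.trans hlt'.le, by rw [h2, map_add, map_add, hw], h3⟩

/-- Binomials in a toric ideal form a Gröbner basis once distinct standard monomials have distinct
weights: the leading monomial of an element of the ideal shares its weight with a smaller
monomial, hence with a smaller standard one, so it is not standard itself. -/
theorem initialIdeal_eq_initialIdeal_ker {G : Set (MvPolynomial σ K)}
    (hG : ∀ g ∈ G, ∃ s t, g = monomial s 1 - monomial t 1 ∧ t ≺[m] s ∧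
      Finsupp.weight a s = Finsupp.weight a t)
    (hinj : ∀ s t, (∀ g ∈ G, ¬ m.degree g ≤ s) → (∀ g ∈ G, ¬ m.degree g ≤ t) →
      Finsupp.weight a s = Finsupp.weight a t → s = t) :
    G ⊆ (RingHom.ker (aeval (R := K) fun w => AddMonoidAlgebra.single (a w) (1 : K)) :
      Set (MvPolynomial σ K)) ∧
    initialIdeal m G = initialIdeal m
      (RingHom.ker (aeval (R := K) fun w => AddMonoidAlgebra.single (a w) (1 : K)) :
        Set (MvPolynomial σ K)) := by
  have hsub : G ⊆ (RingHom.ker (aeval (R := K) fun w => AddMonoidAlgebra.single (a w) (1 : K)) :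
      Set (MvPolynomial σ K)) := by
    intro g hg
    obtain ⟨s, t, rfl, -, hw⟩ := hG g hg
    simp [RingHom.mem_ker, aeval_single_monomial, hw]
  refine ⟨hsub, le_antisymm (Ideal.span_mono (Set.image_mono hsub)) (Ideal.span_le.2 ?_)⟩
  rintro _ ⟨f, hf, rfl⟩
  by_cases hf0 : f = 0
  · simp [hf0]
  obtain ⟨u, hu, hwu⟩ := exists_lt_degree_weight_eq m a hf0 hf
  obtain ⟨t, htu, hwt, ht⟩ := exists_standard_weight_eq m hG u
  have hns : ∃ g ∈ G, m.degree g ≤ m.degree f := by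
    by_contra! h
    have := hinj t (m.degree f) ht h (hwt.trans hwu)
    exact (htu.trans_lt hu).ne (by rw [this])
  obtain ⟨g, hg, hgf⟩ := hns
  have hg' : m.leadingTerm g ∈ initialIdeal m G := Ideal.subset_span ⟨g, hg, rfl⟩
  obtain ⟨s, t', rfl, hlt, -⟩ := hG g hg
  rw [degree_monomial_sub_monomial hlt] at hgf
  rw [leadingTerm_monomial_sub_monomial hlt] at hg'
  obtain ⟨v, hv⟩ := exists_add_of_le hgf
  have : m.leadingTerm f = monomial v (m.leadingCoeff f) * monomial s 1 := by
    rw [MonomialOrder.leadingTerm, monomial_mul, mul_one, add_comm, ← hv]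
  rw [this]
  exact Ideal.mul_mem_left _ _ hg'

end Toric

/-! ### Lexicographic comparison -/

/-- An exponent involving the variable `w` is lexicographically larger than any exponent supported
on smaller variables. -/
lemma lex_lt_of_pos {σ : Type*} [LinearOrder σ] [WellFoundedGT σ] {s t : σ →₀ ℕ} (w : σ)
    (hs : 0 < s w) (ht : ∀ w' ≤ w, t w' = 0) :
    MonomialOrder.lex.toSyn t < MonomialOrder.lex.toSyn s := by
  have h1 : MonomialOrder.lex.toSyn (Finsupp.single w 1) ≤ MonomialOrder.lex.toSyn s :=
    MonomialOrder.lex.toSyn_monotone (Finsupp.single_le_iff.2 hs)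
  refine lt_of_lt_of_le ?_ h1
  rw [MonomialOrder.lex_lt_iff]
  refine ⟨w, fun j hj => ?_, ?_⟩
  · simp [ht j hj.le, hj.ne]
  · simp [ht w le_rfl]

/-! ### Sums over consecutive values -/

section Consecutive

variable {ι : Type*} {T : Finset ι} {a : ι → ℤ} {p q : ι → ℤ}

lemma exists_forall_le_of_sum_pos (hpos : 0 < ∑ i ∈ T, p i) :
    ∃ i ∈ T, 0 < p i ∧ ∀ j ∈ T, 0 < p j → a i ≤ a j := by
  classical
  have hne : (T.filter fun i => 0 < p i).Nonempty := by
    by_contra h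
    rw [Finset.not_nonempty_iff_eq_empty, Finset.filter_eq_empty_iff] at h
    exact hpos.not_ge (Finset.sum_nonpos fun i hi => not_lt.1 (h hi))
  obtain ⟨i, hi, hmin⟩ := Finset.exists_min_image _ a hne
  rw [Finset.mem_filter] at hi
  exact ⟨i, hi.1, hi.2, fun j hj hj' => hmin j (Finset.mem_filter.2 ⟨hj, hj'⟩)⟩

/-- If two multisets of integers have the same number of elements and the same sum, and the elements
of the first differ by at most one, then a lower bound of the second is a lower bound of the first:
otherwise all elements of the first are at most `a i + 1 ≤ c`, and `a i` is smaller. -/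
lemma min_le_min_of_sum_eq (hp : ∀ i ∈ T, 0 ≤ p i) (hq : ∀ i ∈ T, 0 ≤ q i)
    (hp1 : ∀ i ∈ T, ∀ j ∈ T, 0 < p i → 0 < p j → a i ≤ a j + 1)
    (hsum : ∑ i ∈ T, p i = ∑ i ∈ T, q i) (hmom : ∑ i ∈ T, a i * p i = ∑ i ∈ T, a i * q i)
    {i : ι} (hi : i ∈ T) (hpi : 0 < p i) {c : ℤ}
    (hj : ∀ k ∈ T, 0 < q k → c ≤ a k) : c ≤ a i := by
  by_contra! hlt
  have h1 : ∑ k ∈ T, (a i + 1 - a k) * p k > 0 := by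
    refine Finset.sum_pos' (fun k hk => ?_) ⟨i, hi, by nlinarith⟩
    rcases (hp k hk).eq_or_lt with h | h
    · simp [← h]
    · exact mul_nonneg (by linarith [hp1 k hk i hi h hpi]) h.le
  have h2 : ∑ k ∈ T, (a i + 1 - a k) * q k ≤ 0 := by
    refine Finset.sum_nonpos fun k hk => ?_
    rcases (hq k hk).eq_or_lt with h | h
    · simp [← h]
    · exact mul_nonpos_of_nonpos_of_nonneg (by linarith [hj k hk h]) h.le
  simp only [sub_mul, Finset.sum_sub_distrib, ← Finset.mul_sum] at h1 h2
  rw [hsum, hmom] at h1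
  exact absurd h1 (not_lt.2 h2)

/-- A multiset of integers lying in some interval `{c, c + 1}` is determined by its number of
elements and its sum. -/
theorem eq_of_consecutive (ha : Set.InjOn a T) (hp : ∀ i ∈ T, 0 ≤ p i) (hq : ∀ i ∈ T, 0 ≤ q i)
    (hp1 : ∀ i ∈ T, ∀ j ∈ T, 0 < p i → 0 < p j → a i ≤ a j + 1)
    (hq1 : ∀ i ∈ T, ∀ j ∈ T, 0 < q i → 0 < q j → a i ≤ a j + 1)
    (hsum : ∑ i ∈ T, p i = ∑ i ∈ T, q i) (hmom : ∑ i ∈ T, a i * p i = ∑ i ∈ T, a i * q i) :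
    ∀ i ∈ T, p i = q i := by
  rcases (Finset.sum_nonneg hp).eq_or_lt with h0 | hpos
  · intro i hi
    rw [(Finset.sum_eq_zero_iff_of_nonneg hp).1 h0.symm i hi,
      (Finset.sum_eq_zero_iff_of_nonneg hq).1 (hsum ▸ h0.symm) i hi]
  obtain ⟨i, hi, hpi, himin⟩ := exists_forall_le_of_sum_pos (a := a) hpos
  obtain ⟨j, hj, hqj, hjmin⟩ := exists_forall_le_of_sum_pos (a := a) (hsum ▸ hpos)
  have hij : a i = a j := le_antisymm
    (min_le_min_of_sum_eq hq hp hq1 hsum.symm hmom.symm hj hqj himin)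
    (min_le_min_of_sum_eq hp hq hp1 hsum hmom hi hpi hjmin)
  obtain rfl : i = j := ha hi hj hij
  -- the elements equal to `a i + 1` are counted by the sum of the differences to `a i`
  have key : ∀ p : ι → ℤ, (∀ k ∈ T, 0 ≤ p k) → (∀ k ∈ T, 0 < p k → a i ≤ a k) →
      (∀ k ∈ T, 0 < p k → a k ≤ a i + 1) → ∀ k ∈ T, a k = a i + 1 →
      p k = ∑ l ∈ T, a l * p l - a i * ∑ l ∈ T, p l := by
    intro p hp hmin hmax k hk hak
    rw [Finset.mul_sum, ← Finset.sum_sub_distrib, Finset.sum_eq_single_of_mem k hk]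
    · rw [hak]; ring
    · intro l hl hlk
      rcases (hp l hl).eq_or_lt with h | h
      · simp [← h]
      · have h1 := hmin l hl h
        have h2 := hmax l hl h
        have h3 : a l ≠ a i + 1 := fun h => hlk (ha hl hk (h.trans hak.symm))
        have : a l = a i := by omega
        rw [this]; ring
  have hne : ∀ k ∈ T, k ≠ i → p k = q k := by
    intro k hk hki
    by_cases hak : a k = a i + 1
    · rw [key p hp himin (fun l hl h => hp1 l hl i hi h hpi) k hk hak,
        key q hq hjmin (fun l hl h => hq1 l hl i hi h hqj) k hk hak, hsum, hmom]
    · have h0 : a k ≠ a i := fun h => hki (ha hk hi h)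
      have hpk : ¬ 0 < p k := fun h => by
        have := himin k hk h
        have := hp1 k hk i hi h hpi
        omega
      have hqk : ¬ 0 < q k := fun h => by
        have := hjmin k hk h
        have := hq1 k hk i hi h hqj
        omega
      have := hp k hk
      have := hq k hk
      omega
  intro k hk
  by_cases hki : k = i
  · subst hki
    classical
    rw [← Finset.add_sum_erase T p hk, ← Finset.add_sum_erase T q hk,
      Finset.sum_congr rfl fun l hl =>
        hne l (Finset.mem_of_mem_erase hl) (Finset.ne_of_mem_erase hl)] at hsum
    exact add_right_cancel hsum
  · exact hne k hk hki

end Consecutive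

/-! ### Exponents and weights of the monomials occurring in the binomials -/

section Exponents

variable (r x : ℕ)

/-- The exponent of `z_i`; like `z`, it is indexed by all `i`, and it is `0` out of range. -/
noncomputable def zExp (i : ℕ) : Var r x →₀ ℕ :=
  Finsupp.equivFunOnFinite.symm fun w => match ofLex w with
    | Sum.inl j => if i = j.val + 1 then 1 else 0
    | Sum.inr _ => 0

/-- The exponent of `∏ l ∈ S, y_l`. -/
noncomputable def yExp (S : Finset ℕ) : Var r x →₀ ℕ :=
  Finsupp.equivFunOnFinite.symm fun w => match ofLex w with
    | Sum.inl _ => 0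
    | Sum.inr j => if j.val + 1 ∈ S then 1 else 0

/-- The exponent of `y_1 ⋯ y_{r-1}`. -/
noncomputable def lowExp : Var r x →₀ ℕ := yExp r x (Finset.Icc 1 (r - 1))

/-- The exponent of `y_r ⋯ y_d`. -/
noncomputable def highExp : Var r x →₀ ℕ := yExp r x (Finset.Icc r (dim r x))

variable {r x}

@[simp] lemma zExp_inl (i : ℕ) (j : Fin (r + 3)) :
    zExp r x i (toLex (Sum.inl j)) = if i = j.val + 1 then 1 else 0 := rfl

@[simp] lemma zExp_inr (i : ℕ) (j : Fin (dim r x)) : zExp r x i (toLex (Sum.inr j)) = 0 := rfl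

@[simp] lemma yExp_inl (S : Finset ℕ) (j : Fin (r + 3)) :
    yExp r x S (toLex (Sum.inl j)) = 0 := rfl

@[simp] lemma yExp_inr (S : Finset ℕ) (j : Fin (dim r x)) :
    yExp r x S (toLex (Sum.inr j)) = if j.val + 1 ∈ S then 1 else 0 := rfl

@[simp] lemma lowExp_inl (j : Fin (r + 3)) : lowExp r x (toLex (Sum.inl j)) = 0 := rfl

@[simp] lemma highExp_inl (j : Fin (r + 3)) : highExp r x (toLex (Sum.inl j)) = 0 := rfl

@[simp] lemma lowExp_inr (j : Fin (dim r x)) :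
    lowExp r x (toLex (Sum.inr j)) = if j.val + 1 < r then 1 else 0 := by
  simp only [lowExp, yExp_inr, Finset.mem_Icc]
  exact if_congr (by omega) rfl rfl

@[simp] lemma highExp_inr (j : Fin (dim r x)) :
    highExp r x (toLex (Sum.inr j)) = if r ≤ j.val + 1 then 1 else 0 := by
  simp only [highExp, yExp_inr, Finset.mem_Icc]
  exact if_congr (by omega) rfl rfl

lemma exponent_ext {s t : Var r x →₀ ℕ}
    (hz : ∀ i, s (toLex (Sum.inl i)) = t (toLex (Sum.inl i)))
    (hy : ∀ j, s (toLex (Sum.inr j)) = t (toLex (Sum.inr j))) : s = t := by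
  ext w
  rcases w with i | j
  exacts [hz i, hy j]

variable (K : Type*) [Field K]

lemma z_eq_monomial {i : ℕ} (h1 : 1 ≤ i) (h2 : i ≤ r + 3) :
    z K r x i = monomial (zExp r x i) 1 := by
  rw [z, dif_pos ⟨h1, h2⟩, X]
  congr 2
  refine exponent_ext (fun j => ?_) (fun j => ?_)
  · rw [Finsupp.single_apply, zExp_inl]
    refine if_congr ?_ rfl rfl
    rw [toLex_inj, Sum.inl.injEq, Fin.ext_iff]
    dsimp only
    omega
  · rw [Finsupp.single_apply, if_neg (by simp)]; rfl

lemma y_eq_monomial {l : ℕ} (h1 : 1 ≤ l) (h2 : l ≤ dim r x) :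
    y K r x l = monomial (yExp r x {l}) 1 := by
  rw [y, dif_pos ⟨h1, h2⟩, X]
  congr 2
  refine exponent_ext (fun j => ?_) (fun j => ?_)
  · rw [Finsupp.single_apply, if_neg (by simp)]; rfl
  · rw [Finsupp.single_apply, yExp_inr]
    refine if_congr ?_ rfl rfl
    rw [toLex_inj, Sum.inr.injEq, Fin.ext_iff, Finset.mem_singleton]
    dsimp only
    omega

lemma prod_y_eq_monomial {S : Finset ℕ} (hS : ∀ l ∈ S, 1 ≤ l ∧ l ≤ dim r x) :
    ∏ l ∈ S, y K r x l = monomial (yExp r x S) 1 := by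
  rw [Finset.prod_congr rfl fun l hl => y_eq_monomial K (hS l hl).1 (hS l hl).2,
    ← monomial_sum_one]
  congr 2
  refine exponent_ext (fun j => ?_) (fun j => ?_) <;> simp [Finsupp.finsetSum_apply]

lemma prodLow_eq_monomial : prodLow K r x = monomial (lowExp r x) 1 :=
  prod_y_eq_monomial K fun l hl => by
    rw [Finset.mem_Icc] at hl
    unfold dim
    omega

lemma prodHigh_eq_monomial (hr : 1 < r) : prodHigh K r x = monomial (highExp r x) 1 :=
  prod_y_eq_monomial K fun l hl => by
    rw [Finset.mem_Icc] at hl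
    omega

end Exponents

section Weights

variable (r x : ℕ)

/-- The point `a u + b v` of the plane spanned by the points `a'_i`, in degree `n`. -/
def planePt (a b n : ℤ) : Fin (dim r x + 1) → ℤ :=
  Fin.snoc (α := fun _ => ℤ) (a • u r x + b • v r x) n

/-- The coefficient of `u` in `a'_i`. -/
def uCoeff (i : ℕ) : ℤ := if i ≤ r then r - i + 1 else if i = r + 1 then 1 else 0

/-- The coefficient of `v` in `a'_i`. -/
def vCoeff (i : ℕ) : ℤ := if i ≤ r ∨ i = r + 2 then 1 else 0

variable {r x}

@[simp] lemma planePt_castSucc (a b n : ℤ) (c : Fin (dim r x)) :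
    planePt r x a b n c.castSucc = a * u r x c + b * v r x c := by
  simp [planePt]

@[simp] lemma planePt_last (a b n : ℤ) : planePt r x a b n (Fin.last _) = n := by
  simp [planePt]

lemma planePt_add (a b n a' b' n' : ℤ) :
    planePt r x a b n + planePt r x a' b' n' = planePt r x (a + a') (b + b') (n + n') := by
  ext c
  refine Fin.lastCases ?_ (fun c => ?_) c
  · simp
  · simp; ring

lemma nsmul_planePt (k : ℕ) (a b n : ℤ) :
    k • planePt r x a b n = planePt r x (k * a) (k * b) (k * n) := by
  ext c
  refine Fin.lastCases ?_ (fun c => ?_) c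
  · simp
  · simp; ring

lemma aPt_eq (i : ℕ) : aPt r x i = uCoeff r i • u r x + vCoeff r i • v r x := by
  unfold aPt uCoeff vCoeff
  split_ifs <;> first | omega | simp

lemma sum_var {M : Type*} [AddCommMonoid M] (f : Var r x → M) :
    ∑ w, f w = ∑ i, f (toLex (Sum.inl i)) + ∑ j, f (toLex (Sum.inr j)) := by
  rw [← Equiv.sum_comp toLex, Fintype.sum_sum_type]

/-- The value of the weight of `z^α y^β` at the coordinate `e_{d-j+1}`: the exponent `β_j`
contributes directly, and the exponents `α_i` only through the sums `∑ α_i a'_i`. -/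
lemma weight_castSucc (s : Var r x →₀ ℕ) (c : Fin (dim r x)) :
    Finsupp.weight (config r x) s c.castSucc =
      (∑ i : Fin (r + 3), uCoeff r (i + 1) * s (toLex (Sum.inl i))) * u r x c +
      (∑ i : Fin (r + 3), vCoeff r (i + 1) * s (toLex (Sum.inl i))) * v r x c +
      s (toLex (Sum.inr c.rev)) := by
  rw [Finsupp.weight_eq_sum, sum_var, Pi.add_apply, Finset.sum_apply, Finset.sum_apply,
    Finset.sum_mul, Finset.sum_mul, ← Finset.sum_add_distrib]
  congr 1
  · refine Finset.sum_congr rfl fun i _ => ?_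
    simp [config, homogenize, aPt_eq]
    ring
  · rw [Finset.sum_eq_single c.rev]
    · simp [config, homogenize, bPt]
      omega
    · intro j _ hj
      simp only [config, homogenize, ofLex_toLex, Pi.smul_apply, Fin.snoc_castSucc, bPt]
      rw [if_neg, smul_zero]
      intro h
      apply hj
      rw [Fin.ext_iff, Fin.val_rev]
      omega
    · simp

lemma weight_last (s : Var r x →₀ ℕ) :
    Finsupp.weight (config r x) s (Fin.last _) =
      ∑ i : Fin (r + 3), (s (toLex (Sum.inl i)) : ℤ) +
      ∑ j : Fin (dim r x), (s (toLex (Sum.inr j)) : ℤ) := by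
  rw [Finsupp.weight_eq_sum, sum_var, Pi.add_apply, Finset.sum_apply, Finset.sum_apply]
  simp [config, homogenize]

lemma weight_zExp {i : ℕ} (h1 : 1 ≤ i) (h2 : i ≤ r + 3) :
    Finsupp.weight (config r x) (zExp r x i) = planePt r x (uCoeff r i) (vCoeff r i) 1 := by
  obtain ⟨i, rfl⟩ := Nat.exists_eq_add_of_le' h1
  have hk : ∀ f : Fin (r + 3) → ℤ,
      (∑ k : Fin (r + 3), f k * ((zExp r x (i + 1) (toLex (Sum.inl k)) : ℕ) : ℤ)) =
        f ⟨i, by omega⟩ := by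
    intro f
    rw [Finset.sum_eq_single ⟨i, by omega⟩]
    · simp
    · intro k _ hk
      rw [zExp_inl, if_neg]
      · simp
      · intro h
        apply hk
        ext
        dsimp only
        omega
    · simp
  ext c
  refine Fin.lastCases ?_ (fun c => ?_) c
  · rw [weight_last]
    simpa using hk fun _ => 1
  · rw [weight_castSucc, hk, hk]
    simp

lemma weight_lowExp (hr : 1 < r) :
    Finsupp.weight (config r x) (lowExp r x) = planePt r x 0 (-1) (r - 1) := by
  ext c
  refine Fin.lastCases ?_ (fun c => ?_) c
  · rw [weight_last, planePt_last]
    simp only [lowExp_inl, lowExp_inr, Nat.cast_zero, Finset.sum_const_zero, zero_add]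
    rw [Fin.sum_univ_eq_sum_range fun j => (((if j + 1 < r then 1 else 0 : ℕ)) : ℤ)]
    have : (Finset.range (dim r x)).filter (fun j => j + 1 < r) = Finset.range (r - 1) := by
      ext j
      simp only [Finset.mem_filter, Finset.mem_range, dim]
      omega
    simp only [Nat.cast_ite, Nat.cast_one, Nat.cast_zero]
    rw [Finset.sum_boole, this, Finset.card_range]
    omega
  · rw [weight_castSucc]
    have := c.isLt
    unfold dim at this
    simp [v, Fin.val_rev]
    split_ifs <;> first | rfl | (exfalso; unfold dim at *; omega)

lemma weight_highExp (hr : 1 < r) :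
    Finsupp.weight (config r x) (highExp r x) = planePt r x (-1) x x := by
  ext c
  refine Fin.lastCases ?_ (fun c => ?_) c
  · rw [weight_last, planePt_last]
    simp only [highExp_inl, highExp_inr, Nat.cast_zero, Finset.sum_const_zero, zero_add]
    rw [Fin.sum_univ_eq_sum_range fun j => (((if r ≤ j + 1 then 1 else 0 : ℕ)) : ℤ)]
    have : (Finset.range (dim r x)).filter (fun j => r ≤ j + 1) = Finset.Ico (r - 1) (dim r x) := by
      ext j
      simp only [Finset.mem_filter, Finset.mem_range, Finset.mem_Ico]
      omega
    simp only [Nat.cast_ite, Nat.cast_one, Nat.cast_zero]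
    rw [Finset.sum_boole, this, Nat.card_Ico]
    unfold dim
    omega
  · rw [weight_castSucc]
    have := c.isLt
    unfold dim at this
    simp [u, v, Fin.val_rev]
    split_ifs <;> first | (exfalso; unfold dim at *; omega) | simp

/-- A monomial divisible by `z_i` is lexicographically larger than every monomial whose
`z`-variables all have index larger than `i`. -/
lemma lt_zExp_add {i : ℕ} (h1 : 1 ≤ i) (h2 : i ≤ r + 3) (s : Var r x →₀ ℕ) {t : Var r x →₀ ℕ}
    (ht : ∀ j : Fin (r + 3), j.val + 1 ≤ i → t (toLex (Sum.inl j)) = 0) :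
    MonomialOrder.lex.toSyn t < MonomialOrder.lex.toSyn (zExp r x i + s) := by
  refine lex_lt_of_pos (toLex (Sum.inl ⟨i - 1, by omega⟩)) ?_ ?_
  · rw [Finsupp.add_apply, zExp_inl, if_pos (by dsimp only; omega)]
    omega
  · intro w hw
    rcases w with j | j
    · refine ht j ?_
      have : j ≤ ⟨i - 1, by omega⟩ := Sum.Lex.inl_le_inl_iff.1 hw
      rw [Fin.le_def] at this
      dsimp only at this
      omega
    · exact absurd hw Sum.Lex.not_inr_le_inl

end Weights

/-! ### The binomials and their leading monomials -/

section Binomials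

variable {r x : ℕ}

/-- The exponents `s`, `t` of the leading and the trailing monomial of a binomial of the toric
ideal. -/
structure IsLexBinomial (s t : Var r x →₀ ℕ) : Prop where
  lt : MonomialOrder.lex.toSyn t < MonomialOrder.lex.toSyn s
  weight_eq : Finsupp.weight (config r x) s = Finsupp.weight (config r x) t

variable (K : Type*) [Field K]

/-- `z_i z_j - z_k z_ℓ` for `(i, j) ∈ B`. Both `k` and `ℓ` are larger than `i`, and
`a'_i + a'_j = a'_k + a'_ℓ`. -/
lemma quadric_spec {p : ℕ × ℕ} (hp : p ∈ B r) :
    ∃ t, z K r x p.1 * z K r x p.2 - z K r x (kl r p).1 * z K r x (kl r p).2 =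
      monomial (zExp r x p.1 + zExp r x p.2) 1 - monomial t 1 ∧
      IsLexBinomial (zExp r x p.1 + zExp r x p.2) t := by
  obtain ⟨i, j⟩ := p
  obtain ⟨h1, h2, h3, h4, h5, h6⟩ := hp
  simp only [ne_eq, Prod.mk.injEq, not_and] at h1 h2 h3 h4 h5 h6
  obtain ⟨k, l, hkl⟩ : ∃ k l, kl r (i, j) = (k, l) := ⟨_, _, rfl⟩
  have hk : i < k ∧ k ≤ l ∧ l ≤ r + 3 := by
    unfold kl at hkl
    dsimp only at hkl
    split_ifs at hkl <;> obtain ⟨rfl, rfl⟩ := Prod.mk.inj hkl <;> omega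
  have hu : uCoeff r i + uCoeff r j = uCoeff r k + uCoeff r l := by
    unfold kl at hkl
    dsimp only at hkl
    unfold uCoeff
    split_ifs at hkl <;> obtain ⟨rfl, rfl⟩ := Prod.mk.inj hkl <;> split_ifs <;> omega
  have hv : vCoeff r i + vCoeff r j = vCoeff r k + vCoeff r l := by
    unfold kl at hkl
    dsimp only at hkl
    unfold vCoeff
    split_ifs at hkl <;> obtain ⟨rfl, rfl⟩ := Prod.mk.inj hkl <;> split_ifs <;> omega
  rw [hkl]
  dsimp only
  refine ⟨zExp r x k + zExp r x l, ?_, lt_zExp_add h2 (by omega) _ fun c hc => ?_, ?_⟩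
  · rw [z_eq_monomial K h2 (by omega), z_eq_monomial K (by omega) h4,
      z_eq_monomial K (i := k) (by omega) (by omega),
      z_eq_monomial K (i := l) (by omega) (by omega)]
    simp [monomial_mul]
  · rw [Finsupp.add_apply, zExp_inl, zExp_inl, if_neg (by omega), if_neg (by omega)]
  · rw [map_add, map_add, weight_zExp h2 (by omega), weight_zExp (by omega) h4,
      weight_zExp (i := k) (by omega) (by omega), weight_zExp (i := l) (by omega) (by omega),
      planePt_add, planePt_add, hu, hv]

/-- The binomials `z_i ∏ y - z_j^m z_l^n` whose trailing variables have index larger than `i`. -/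
lemma z_mul_sub_pow_mul_pow_spec {e : Var r x →₀ ℕ} {a b c : ℤ}
    (he : Finsupp.weight (config r x) e = planePt r x a b c) {i j l m n : ℕ}
    (hi : 1 ≤ i) (hij : i < j ∨ m = 0) (hil : i < l) (hir : i ≤ r + 3)
    (hj : 1 ≤ j) (hj' : j ≤ r + 3) (hl : 1 ≤ l) (hl' : l ≤ r + 3)
    (hu : uCoeff r i + a = m * uCoeff r j + n * uCoeff r l)
    (hv : vCoeff r i + b = m * vCoeff r j + n * vCoeff r l)
    (hd : 1 + c = m + n) :
    ∃ t, z K r x i * monomial e 1 - z K r x j ^ m * z K r x l ^ n =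
      monomial (zExp r x i + e) 1 - monomial t 1 ∧ IsLexBinomial (zExp r x i + e) t := by
  refine ⟨m • zExp r x j + n • zExp r x l, ?_, lt_zExp_add hi hir _ fun c hc => ?_, ?_⟩
  · rw [z_eq_monomial K hi hir, z_eq_monomial K hj hj', z_eq_monomial K hl hl']
    simp [monomial_mul, monomial_pow]
  · rw [Finsupp.add_apply, Finsupp.smul_apply, Finsupp.smul_apply, zExp_inl, zExp_inl]
    rw [if_neg (c := l = _) (by omega)]
    rcases hij with hij | rfl
    · rw [if_neg (by omega)]; simp
    · simp
  · rw [map_add, map_add, map_nsmul, map_nsmul, weight_zExp hi hir, weight_zExp hj hj',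
      weight_zExp hl hl', he, nsmul_planePt, nsmul_planePt, planePt_add, planePt_add, hu, hv, hd]
    simp

/-- `z_{k+1} y_1 ⋯ y_{r-1} - z_{r+1}^{r-k} z_{r+3}^k`. -/
lemma family2_spec (hr : 1 < r) {k : ℕ} (hk : k ≤ r - 1) :
    ∃ t, z K r x (k + 1) * prodLow K r x - z K r x (r + 1) ^ (r - k) * z K r x (r + 3) ^ k =
      monomial (zExp r x (k + 1) + lowExp r x) 1 - monomial t 1 ∧
      IsLexBinomial (zExp r x (k + 1) + lowExp r x) t := by
  rw [prodLow_eq_monomial]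
  have : k ≤ r := by omega
  have h3 : k + 1 ≤ r := by omega
  apply z_mul_sub_pow_mul_pow_spec K (weight_lowExp hr) <;> try omega
  all_goals simp [uCoeff, vCoeff, Nat.cast_sub this, h3]
  ring

/-- `z_{r+2} y_1 ⋯ y_{r-1} - z_{r+3}^r`. -/
lemma binomial4_spec (hr : 1 < r) :
    ∃ t, binomial4 K r x = monomial (zExp r x (r + 2) + lowExp r x) 1 - monomial t 1 ∧
      IsLexBinomial (zExp r x (r + 2) + lowExp r x) t := by
  have := z_mul_sub_pow_mul_pow_spec K (weight_lowExp (x := x) hr) (i := r + 2) (j := r + 3)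
    (l := r + 3) (m := 0) (n := r) (by omega) (by omega) (by omega) (by omega) (by omega)
    (by omega) (by omega) (by omega) (by simp [uCoeff]) (by simp [vCoeff]) (by simp)
  simpa only [binomial4, pow_zero, one_mul, ← prodLow_eq_monomial] using this

/-- `z_{r+1} y_r ⋯ y_d - z_{r+2}^x z_{r+3}`. -/
lemma binomial5_spec (hr : 1 < r) :
    ∃ t, binomial5 K r x = monomial (zExp r x (r + 1) + highExp r x) 1 - monomial t 1 ∧
      IsLexBinomial (zExp r x (r + 1) + highExp r x) t := by
  have := z_mul_sub_pow_mul_pow_spec K (weight_highExp (x := x) hr) (i := r + 1) (j := r + 2)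
    (l := r + 3) (m := x) (n := 1) (by omega) (by omega) (by omega) (by omega) (by omega)
    (by omega) (by omega) (by omega) (by simp [uCoeff]) (by simp [vCoeff]) (by simp; ring)
  simpa only [binomial5, pow_one, ← prodHigh_eq_monomial K hr] using this

/-- `z_{r-k} y_r ⋯ y_d - z_r^k z_{r+2}^{x+1-k}`, where the last exponent has to be an honest
difference. -/
lemma family3_spec (hr : 1 < r) {k : ℕ} (hk : k ≤ r - 1) (hkx : k ≤ x + 1) :
    ∃ t, z K r x (r - k) * prodHigh K r x - z K r x r ^ k * z K r x (r + 2) ^ (x + 1 - k) =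
      monomial (zExp r x (r - k) + highExp r x) 1 - monomial t 1 ∧
      IsLexBinomial (zExp r x (r - k) + highExp r x) t := by
  rw [prodHigh_eq_monomial K hr]
  have : k ≤ r := by omega
  apply z_mul_sub_pow_mul_pow_spec K (weight_highExp hr) <;> try omega
  all_goals simp [uCoeff, vCoeff, Nat.cast_sub this, Nat.cast_sub hkx]
  ring

/-- `z_{r-k} y_r ⋯ y_d - z_{r-q}^s z_{r-q+1}^{x+1-s}`: both monomials have weight
`k u + (x + 1) v`, as `k = (q + 1) s + q (x + 1 - s)`. -/
lemma family3star_spec_of_lt (hr : 1 < r) (hx : 1 ≤ x) {k q s : ℕ} (hk : k ≤ r - 1)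
    (hs : s ≤ x + 1) (hq : 1 ≤ q) (hkq : k = q * (x + 1) + s) :
    ∃ t, z K r x (r - k) * prodHigh K r x -
        z K r x (r - q) ^ s * z K r x (r - q + 1) ^ (x + 1 - s) =
      monomial (zExp r x (r - k) + highExp r x) 1 - monomial t 1 ∧
      IsLexBinomial (zExp r x (r - k) + highExp r x) t := by
  rw [prodHigh_eq_monomial K hr]
  have hlt : q < k := by nlinarith
  have h1 : k ≤ r := by omega
  have h2 : q ≤ r := by omega
  have h3 : r - q + 1 ≤ r := by omega
  apply z_mul_sub_pow_mul_pow_spec K (weight_highExp hr) <;> try omega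
  all_goals simp [uCoeff, vCoeff, Nat.cast_sub h1, Nat.cast_sub h2, Nat.cast_sub hs, h3]
  · rw [hkq]
    push_cast
    ring
  · ring

lemma family3star_spec (hr : 1 < r) (hx : 1 ≤ x) {k : ℕ} (hk : k ≤ r - 1) :
    ∃ t, z K r x (r - k) * prodHigh K r x - tail3star K r x k =
      monomial (zExp r x (r - k) + highExp r x) 1 - monomial t 1 ∧
      IsLexBinomial (zExp r x (r - k) + highExp r x) t := by
  unfold tail3star
  split_ifs with h1 h2
  · exact family3_spec K hr hk h1
  · have := family3star_spec_of_lt K hr hx hk (q := 1) (s := k - x - 1) (by omega) le_rfl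
      (by omega)
    rwa [show r - 1 + 1 = r by omega, show x + 1 - (k - x - 1) = 2 * x + 2 - k by omega] at this
  · exact family3star_spec_of_lt K hr hx hk (Nat.mod_lt k (Nat.succ_pos x)).le
      ((Nat.one_le_div_iff (Nat.succ_pos x)).2 (by omega)) (Nat.div_add_mod' k (x + 1)).symm

lemma zExp_add_zExp_le_one {i j : ℕ} (hij : i ≠ j) (w : Var r x) :
    (zExp r x i + zExp r x j) w ≤ 1 := by
  rcases w with c | c
  · change (if i = c.val + 1 then 1 else 0) + (if j = c.val + 1 then 1 else 0) ≤ 1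
    split_ifs <;> omega
  · exact Nat.zero_le 1

lemma zExp_add_yExp_le_one (i : ℕ) (S : Finset ℕ) (w : Var r x) :
    (zExp r x i + yExp r x S) w ≤ 1 := by
  rcases w with c | c
  · change (if i = c.val + 1 then 1 else 0) + 0 ≤ 1
    split_ifs <;> omega
  · change 0 + (if c.val + 1 ∈ S then 1 else 0) ≤ 1
    split_ifs <;> omega

lemma basis_spec (hr : 1 < r) (hx : 1 ≤ x) {g : MvPolynomial (Var r x) K}
    (hg : g ∈ basis K r x) :
    ∃ s t, g = monomial s 1 - monomial t 1 ∧ IsLexBinomial s t ∧ ∀ w, s w ≤ 1 := by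
  rcases hg with ((⟨p, hp, rfl⟩ | ⟨k, hk, rfl⟩) | hg) | (rfl | rfl)
  · obtain ⟨t, ht, hst⟩ := quadric_spec (x := x) K hp
    exact ⟨_, t, ht, hst, zExp_add_zExp_le_one (by have := hp.1; omega)⟩
  · obtain ⟨t, ht, hst⟩ := family2_spec (x := x) K hr hk
    exact ⟨_, t, ht, hst, zExp_add_yExp_le_one _ _⟩
  · split_ifs at hg with h
    · obtain ⟨k, hk, rfl⟩ := hg
      obtain ⟨t, ht, hst⟩ := family3_spec (x := x) K hr hk (by omega)
      exact ⟨_, t, ht, hst, zExp_add_yExp_le_one _ _⟩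
    · obtain ⟨k, hk, rfl⟩ := hg
      obtain ⟨t, ht, hst⟩ := family3star_spec K hr hx hk
      exact ⟨_, t, ht, hst, zExp_add_yExp_le_one _ _⟩
  · obtain ⟨t, ht, hst⟩ := binomial4_spec (x := x) K hr
    exact ⟨_, t, ht, hst, zExp_add_yExp_le_one _ _⟩
  · obtain ⟨t, ht, hst⟩ := binomial5_spec (x := x) K hr
    exact ⟨_, t, ht, hst, zExp_add_yExp_le_one _ _⟩

lemma exists_degree_eq_quadric {p : ℕ × ℕ} (hp : p ∈ B r) :
    ∃ g ∈ basis K r x, MonomialOrder.lex.degree g = zExp r x p.1 + zExp r x p.2 := by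
  obtain ⟨t, ht, hst⟩ := quadric_spec (x := x) K hp
  exact ⟨_, Or.inl (Or.inl (Or.inl ⟨p, hp, rfl⟩)), ht ▸ degree_monomial_sub_monomial hst.lt⟩

lemma exists_degree_eq_low (hr : 1 < r) {i : ℕ} (h1 : 1 ≤ i) (hi : i ≤ r ∨ i = r + 2) :
    ∃ g ∈ basis K r x, MonomialOrder.lex.degree g = zExp r x i + lowExp r x := by
  rcases hi with hi | rfl
  · obtain ⟨k, rfl⟩ := Nat.exists_eq_add_of_le' h1
    obtain ⟨t, ht, hst⟩ := family2_spec (x := x) K hr (k := k) (by omega)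
    exact ⟨_, Or.inl (Or.inl (Or.inr ⟨k, by omega, rfl⟩)),
      ht ▸ degree_monomial_sub_monomial hst.lt⟩
  · obtain ⟨t, ht, hst⟩ := binomial4_spec (x := x) K hr
    exact ⟨_, Or.inr (Or.inl rfl), ht ▸ degree_monomial_sub_monomial hst.lt⟩

lemma exists_degree_eq_high (hr : 1 < r) (hx : 1 ≤ x) {i : ℕ} (h1 : 1 ≤ i) (hi : i ≤ r + 1) :
    ∃ g ∈ basis K r x, MonomialOrder.lex.degree g = zExp r x i + highExp r x := by
  rcases hi.eq_or_lt with rfl | hi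
  · obtain ⟨t, ht, hst⟩ := binomial5_spec (x := x) K hr
    exact ⟨_, Or.inr (Or.inr rfl), ht ▸ degree_monomial_sub_monomial hst.lt⟩
  · obtain ⟨k, hk, rfl⟩ : ∃ k, k ≤ r - 1 ∧ i = r - k := ⟨r - i, by omega, by omega⟩
    by_cases h : r ≤ x + 2
    · obtain ⟨t, ht, hst⟩ := family3_spec (x := x) K hr hk (by omega)
      refine ⟨_, Or.inl (Or.inr ?_), ht ▸ degree_monomial_sub_monomial hst.lt⟩
      rw [if_pos h]
      exact ⟨k, hk, rfl⟩
    · obtain ⟨t, ht, hst⟩ := family3star_spec K hr hx hk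
      refine ⟨_, Or.inl (Or.inr ?_), ht ▸ degree_monomial_sub_monomial hst.lt⟩
      rw [if_neg h]
      exact ⟨k, hk, rfl⟩

lemma basis_finite : (basis K r x).Finite := by
  have hI : ∀ f : ℕ → MvPolynomial (Var r x) K,
      {g | ∃ k : ℕ, k ≤ r - 1 ∧ g = f k}.Finite := fun f =>
    ((Set.finite_Iic (r - 1)).image f).subset fun g ⟨k, hk, h⟩ => ⟨k, hk, h.symm⟩
  have hB : (B r).Finite :=
    (Set.finite_Iic (r, r + 3)).subset fun p hp => Prod.mk_le_mk.2 ⟨hp.2.2.1, hp.2.2.2.1⟩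
  refine ((Set.Finite.union ?_ (hI _)).union ?_).union (Set.toFinite _)
  · exact (hB.image _).subset fun g ⟨p, hp, h⟩ => ⟨p, hp, h.symm⟩
  · split_ifs
    exacts [hI _, hI _]

end Binomials

/-! ### Distinct standard monomials have distinct weights -/

section Standard

variable {r x : ℕ}

/-- The exponents of the monomials not divisible by any leading monomial of the binomials. -/
structure IsStandard (s : Var r x →₀ ℕ) : Prop where
  quadric : ∀ i j : Fin (r + 3), (i.val + 1, j.val + 1) ∈ B r →
    s (toLex (Sum.inl i)) = 0 ∨ s (toLex (Sum.inl j)) = 0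
  low : ∀ i : Fin (r + 3), (i.val + 1 ≤ r ∨ i.val + 1 = r + 2) → 0 < s (toLex (Sum.inl i)) →
    ∃ j : Fin (dim r x), j.val + 1 < r ∧ s (toLex (Sum.inr j)) = 0
  high : ∀ i : Fin (r + 3), i.val + 1 ≤ r + 1 → 0 < s (toLex (Sum.inl i)) →
    ∃ j : Fin (dim r x), r ≤ j.val + 1 ∧ s (toLex (Sum.inr j)) = 0

lemma exponent_le_iff {s t : Var r x →₀ ℕ} : s ≤ t ↔
    (∀ i, s (toLex (Sum.inl i)) ≤ t (toLex (Sum.inl i))) ∧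
    ∀ j, s (toLex (Sum.inr j)) ≤ t (toLex (Sum.inr j)) := by
  refine ⟨fun h => ⟨fun i => h _, fun j => h _⟩, fun h w => ?_⟩
  rcases w with i | j
  exacts [h.1 i, h.2 j]

lemma isStandard_of_not_degree_le (K : Type*) [Field K] (hr : 1 < r) (hx : 1 ≤ x)
    {s : Var r x →₀ ℕ} (hs : ∀ g ∈ basis K r x, ¬ MonomialOrder.lex.degree g ≤ s) :
    IsStandard s := by
  refine ⟨fun i j hij => ?_, fun i hi hpos => ?_, fun i hi hpos => ?_⟩
  · obtain ⟨g, hg, hdeg⟩ := exists_degree_eq_quadric (x := x) K hij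
    by_contra! h
    refine hs g hg (hdeg ▸ exponent_le_iff.2 ⟨fun k => ?_, fun k => by simp⟩)
    have h1 := hij.1
    dsimp only at h1
    rw [Finsupp.add_apply, zExp_inl, zExp_inl]
    dsimp only
    split_ifs with h2 h3 h3
    · omega
    · obtain rfl : i = k := by ext; omega
      omega
    · obtain rfl : j = k := by ext; omega
      omega
    · omega
  · obtain ⟨g, hg, hdeg⟩ := exists_degree_eq_low (x := x) K hr (Nat.succ_pos i.val) hi
    by_contra! h
    refine hs g hg (hdeg ▸ exponent_le_iff.2 ⟨fun k => ?_, fun k => ?_⟩)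
    · rw [Finsupp.add_apply, zExp_inl, lowExp_inl, add_zero]
      split_ifs with h2
      · obtain rfl : i = k := by ext; omega
        omega
      · omega
    · rw [Finsupp.add_apply, zExp_inr, lowExp_inr, zero_add]
      split_ifs with h2
      · have := h k h2
        omega
      · omega
  · obtain ⟨g, hg, hdeg⟩ := exists_degree_eq_high (x := x) K hr hx (Nat.succ_pos i.val) hi
    by_contra! h
    refine hs g hg (hdeg ▸ exponent_le_iff.2 ⟨fun k => ?_, fun k => ?_⟩)
    · rw [Finsupp.add_apply, zExp_inl, highExp_inl, add_zero]
      split_ifs with h2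
      · obtain rfl : i = k := by ext; omega
        omega
      · omega
    · rw [Finsupp.add_apply, zExp_inr, highExp_inr, zero_add]
      split_ifs with h2
      · have := h k h2
        omega
      · omega

/-- The coefficient of `u` in the sum of the points `a'_i` belonging to an exponent. -/
def uSum (s : Var r x →₀ ℕ) : ℤ :=
  ∑ i : Fin (r + 3), uCoeff r (i + 1) * s (toLex (Sum.inl i))

/-- The coefficient of `v` in the sum of the points `a'_i` belonging to an exponent. -/
def vSum (s : Var r x →₀ ℕ) : ℤ :=
  ∑ i : Fin (r + 3), vCoeff r (i + 1) * s (toLex (Sum.inl i))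

/-- The degree of a monomial in the variables `z_i`. -/
def zDegree (s : Var r x →₀ ℕ) : ℤ := ∑ i : Fin (r + 3), (s (toLex (Sum.inl i)) : ℤ)

lemma uCoeff_nonneg (i : ℕ) : 0 ≤ uCoeff r i := by
  unfold uCoeff
  split_ifs <;> omega

lemma vCoeff_nonneg (i : ℕ) : 0 ≤ vCoeff r i := by
  unfold vCoeff
  split_ifs <;> omega

lemma uSum_nonneg (s : Var r x →₀ ℕ) : 0 ≤ uSum s :=
  Finset.sum_nonneg fun _ _ => mul_nonneg (uCoeff_nonneg _) (Int.natCast_nonneg _)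

lemma vSum_nonneg (s : Var r x →₀ ℕ) : 0 ≤ vSum s :=
  Finset.sum_nonneg fun _ _ => mul_nonneg (vCoeff_nonneg _) (Int.natCast_nonneg _)

lemma exists_pos_of_sum_mul_pos {f : ℕ → ℤ} (s : Var r x →₀ ℕ)
    (h : 0 < ∑ i : Fin (r + 3), f (i + 1) * s (toLex (Sum.inl i))) :
    ∃ i : Fin (r + 3), 0 < f (i + 1) ∧ 0 < s (toLex (Sum.inl i)) := by
  by_contra! hne
  refine h.not_ge (Finset.sum_nonpos fun i _ => ?_)
  by_cases hi : 0 < f (i + 1)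
  · simp [Nat.le_zero.1 (hne i hi)]
  · exact mul_nonpos_of_nonpos_of_nonneg (not_lt.1 hi) (Int.natCast_nonneg _)

variable {s t : Var r x →₀ ℕ}

/-- On the coordinates where `u` is `-1` and `v` is `0`, a standard monomial with `uSum s > 0` has
some `y`-exponent equal to `0`, so that the smallest of these coordinates of its weight is
`-uSum s`; for the other monomial this coordinate is at least `-uSum t`. -/
lemma uSum_le (hs : IsStandard s)
    (h : Finsupp.weight (config r x) s = Finsupp.weight (config r x) t) :
    uSum s ≤ uSum t := by
  by_contra! hlt
  obtain ⟨i, hi, hpos⟩ := exists_pos_of_sum_mul_pos s ((uSum_nonneg t).trans_lt hlt)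
  have hi' : i.val + 1 ≤ r + 1 := by
    unfold uCoeff at hi
    split_ifs at hi <;> omega
  obtain ⟨j, hj, hsj⟩ := hs.high i hi' hpos
  have hc : j.rev.val < x := by
    have := j.isLt
    rw [Fin.val_rev]
    unfold dim at this ⊢
    omega
  have hw := congrFun h j.rev.castSucc
  rw [weight_castSucc, weight_castSucc, Fin.rev_rev, hsj, ← uSum, ← uSum, ← vSum, ← vSum] at hw
  simp only [u, v, if_pos hc] at hw
  omega

/-- The analogue of `uSum_le` on the coordinates where `v` is `-1`. -/
lemma vSum_le (hs : IsStandard s)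
    (h : Finsupp.weight (config r x) s = Finsupp.weight (config r x) t) (hu : uSum s = uSum t) :
    vSum s ≤ vSum t := by
  by_contra! hlt
  obtain ⟨i, hi, hpos⟩ := exists_pos_of_sum_mul_pos s ((vSum_nonneg t).trans_lt hlt)
  have hi' : i.val + 1 ≤ r ∨ i.val + 1 = r + 2 := by
    unfold vCoeff at hi
    split_ifs at hi <;> omega
  obtain ⟨j, hj, hsj⟩ := hs.low i hi' hpos
  have hc : ¬ j.rev.val < x := by
    rw [Fin.val_rev]
    unfold dim
    omega
  have hw := congrFun h j.rev.castSucc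
  rw [weight_castSucc, weight_castSucc, Fin.rev_rev, hsj, ← uSum, ← uSum, ← vSum, ← vSum, hu] at hw
  simp only [u, v, if_neg hc] at hw
  omega

/-- The exponent of `z_{r+1}`, the variable of the point `u`. -/
def uExp (s : Var r x →₀ ℕ) : ℕ := s (toLex (Sum.inl ⟨r, by omega⟩))

/-- The exponent of `z_{r+3}`, the variable of the origin. -/
def originExp (s : Var r x →₀ ℕ) : ℕ := s (toLex (Sum.inl ⟨r + 2, by omega⟩))

lemma sum_ite_mul (s : Var r x →₀ ℕ) (k : Fin (r + 3)) :
    ∑ i : Fin (r + 3), (if i = k then 1 else 0) * (s (toLex (Sum.inl i)) : ℤ) =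
      s (toLex (Sum.inl k)) := by
  simp

lemma zDegree_eq (s : Var r x →₀ ℕ) : zDegree s = vSum s + uExp s + originExp s := by
  rw [uExp, originExp, ← sum_ite_mul, ← sum_ite_mul, vSum, zDegree, ← Finset.sum_add_distrib,
    ← Finset.sum_add_distrib]
  refine Finset.sum_congr rfl fun i _ => ?_
  have : vCoeff r (i + 1) + (if i = ⟨r, by omega⟩ then 1 else 0) +
      (if i = ⟨r + 2, by omega⟩ then 1 else 0) = 1 := by
    simp only [Fin.ext_iff, vCoeff]
    split_ifs <;> omega
  rw [← add_mul, ← add_mul, this, one_mul]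

lemma uExp_le_uSum (s : Var r x →₀ ℕ) : (uExp s : ℤ) ≤ uSum s := by
  rw [uExp, ← sum_ite_mul, uSum]
  refine Finset.sum_le_sum fun i _ => mul_le_mul_of_nonneg_right ?_ (Int.natCast_nonneg _)
  simp only [Fin.ext_iff, uCoeff]
  split_ifs <;> omega

/-- In a standard monomial divisible by `z_{r+3}` the only other `z`-variables are `z_{r+1}` and
`z_{r+2}`. -/
lemma uSum_eq_of_originExp_pos (hs : IsStandard s) (h : 0 < originExp s) :
    uSum s = uExp s := by
  rw [uExp, ← sum_ite_mul, uSum]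
  refine Finset.sum_congr rfl fun i _ => ?_
  by_cases hi : i.val + 1 ≤ r
  · have hB : (i.val + 1, (⟨r + 2, by omega⟩ : Fin (r + 3)).val + 1) ∈ B r := by
      refine ⟨?_, ?_, hi, ?_, ?_, ?_⟩ <;> simp; omega
    have := hs.quadric i ⟨r + 2, by omega⟩ hB
    rw [originExp] at h
    rw [this.resolve_right h.ne']
    simp
  · congr 1
    simp only [Fin.ext_iff, uCoeff]
    split_ifs <;> omega

lemma originExp_le (hs : IsStandard s) (hu : uSum s = uSum t)
    (hv : vSum s = vSum t) (hz : zDegree s = zDegree t) : originExp s ≤ originExp t := by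
  by_contra! hlt
  have h1 := uSum_eq_of_originExp_pos hs (Nat.zero_lt_of_lt hlt)
  have h2 := uExp_le_uSum t
  have h3 := zDegree_eq s
  have h4 := zDegree_eq t
  omega

/-- The (0-based) indices of the variables of the points `c u + v`, `0 ≤ c ≤ r`. -/
def lineIdx (r : ℕ) : Finset (Fin (r + 3)) :=
  Finset.univ.filter fun i => i.val + 1 ≤ r ∨ i.val + 1 = r + 2

/-- The points `c u + v` whose variables divide a standard monomial are at most two neighbours. -/
lemma IsStandard.uCoeff_le (hs : IsStandard s) {i j : Fin (r + 3)}
    (hj : j ∈ lineIdx r) (hsi : 0 < s (toLex (Sum.inl i))) (hsj : 0 < s (toLex (Sum.inl j))) :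
    uCoeff r (i + 1) ≤ uCoeff r (j + 1) + 1 := by
  by_contra! hlt
  simp only [lineIdx, Finset.mem_filter, Finset.mem_univ, true_and] at hj
  have hB : (i.val + 1, j.val + 1) ∈ B r := by
    unfold uCoeff at hlt
    refine ⟨?_, ?_, ?_, ?_, ?_, ?_⟩ <;> simp only [ne_eq, Prod.mk.injEq] <;>
      split_ifs at hlt <;> omega
  rcases hs.quadric i j hB with h | h <;> omega

lemma vSum_eq_sum_lineIdx (s : Var r x →₀ ℕ) :
    vSum s = ∑ i ∈ lineIdx r, (s (toLex (Sum.inl i)) : ℤ) := by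
  rw [vSum, lineIdx, Finset.sum_filter]
  refine Finset.sum_congr rfl fun i _ => ?_
  unfold vCoeff
  split_ifs <;> simp

lemma uSum_eq_sum_lineIdx (s : Var r x →₀ ℕ) :
    uSum s = ∑ i ∈ lineIdx r, uCoeff r (i + 1) * (s (toLex (Sum.inl i)) : ℤ) + uExp s := by
  rw [uExp, ← sum_ite_mul, uSum, lineIdx, Finset.sum_filter, ← Finset.sum_add_distrib]
  refine Finset.sum_congr rfl fun i _ => ?_
  simp only [Fin.ext_iff, uCoeff]
  split_ifs <;> omega

lemma injOn_uCoeff : Set.InjOn (fun i : Fin (r + 3) => uCoeff r (i + 1)) (lineIdx r) := by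
  intro i hi j hj h
  simp only [lineIdx, Finset.coe_filter, Finset.mem_univ, true_and, Set.mem_ofPred_eq] at hi hj
  ext
  simp only [uCoeff] at h
  split_ifs at h <;> omega

/-- The triangles spanned by the supports of the standard monomials in the `z_i` are unimodular
and triangulate the convex hull of the points `(c, 1)`, `(1, 0)`, `(0, 0)`; hence the point and the
degree determine the monomial. -/
lemma z_exponents_eq (hs : IsStandard s) (ht : IsStandard t) (hu : uSum s = uSum t)
    (hv : vSum s = vSum t) (hz : zDegree s = zDegree t) (i : Fin (r + 3)) :
    s (toLex (Sum.inl i)) = t (toLex (Sum.inl i)) := by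
  have ho : originExp s = originExp t := le_antisymm (originExp_le hs hu hv hz)
    (originExp_le ht hu.symm hv.symm hz.symm)
  have hue : uExp s = uExp t := by
    have h3 := zDegree_eq s
    have h4 := zDegree_eq t
    omega
  by_cases hi : i ∈ lineIdx r
  · have := eq_of_consecutive (T := lineIdx r) (a := fun i : Fin (r + 3) => uCoeff r (i + 1))
      (p := fun i => (s (toLex (Sum.inl i)) : ℤ)) (q := fun i => (t (toLex (Sum.inl i)) : ℤ))
      injOn_uCoeff (fun _ _ => Int.natCast_nonneg _) (fun _ _ => Int.natCast_nonneg _)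
      (fun i _ j hj h h' => hs.uCoeff_le hj (Int.natCast_pos.1 h) (Int.natCast_pos.1 h'))
      (fun i _ j hj h h' => ht.uCoeff_le hj (Int.natCast_pos.1 h) (Int.natCast_pos.1 h'))
      (by rw [← vSum_eq_sum_lineIdx, ← vSum_eq_sum_lineIdx, hv])
      (by
        have h1 := uSum_eq_sum_lineIdx s
        have h2 := uSum_eq_sum_lineIdx t
        rw [hu, hue, h2] at h1
        exact (add_right_cancel h1).symm) i hi
    exact Int.natCast_inj.1 this
  · simp only [lineIdx, Finset.mem_filter, Finset.mem_univ, true_and] at hi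
    have : i = ⟨r, by omega⟩ ∨ i = ⟨r + 2, by omega⟩ := by
      simp only [Fin.ext_iff]
      omega
    rcases this with h | h <;> rw [h]
    exacts [hue, ho]

theorem IsStandard.eq_of_weight_eq (hs : IsStandard s) (ht : IsStandard t)
    (h : Finsupp.weight (config r x) s = Finsupp.weight (config r x) t) : s = t := by
  have hu : uSum s = uSum t := le_antisymm (uSum_le hs h) (uSum_le ht h.symm)
  have hv : vSum s = vSum t := le_antisymm (vSum_le hs h hu) (vSum_le ht h.symm hu.symm)
  have hy : ∀ j, s (toLex (Sum.inr j)) = t (toLex (Sum.inr j)) := by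
    intro j
    have hw := congrFun h j.rev.castSucc
    rw [weight_castSucc, weight_castSucc, Fin.rev_rev, ← uSum, ← uSum, ← vSum, ← vSum, hu, hv] at hw
    exact Int.natCast_inj.1 (add_left_cancel hw)
  have hz : zDegree s = zDegree t := by
    have hw := congrFun h (Fin.last _)
    rw [weight_last, weight_last, ← zDegree, ← zDegree,
      Finset.sum_congr rfl fun j _ => congrArg Nat.cast (hy j)] at hw
    exact add_right_cancel hw
  exact exponent_ext (z_exponents_eq hs ht hu hv hz) hy

end Standard

end TwoSupported

theorem theorem3p2 (K : Type*) [Field K] (r x : ℕ) (hr : 1 < r) (hx : 1 ≤ x) :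
    TwoSupported.IsGroebnerBasis MonomialOrder.lex (TwoSupported.basis K r x)
      (TwoSupported.toricIdeal K r x) ∧
    (∀ g ∈ TwoSupported.basis K r x, g ≠ 0 ∧ ∀ w, MonomialOrder.lex.degree g w ≤ 1) ∧
    TwoSupported.IsSquarefreeMonomialIdeal
      (TwoSupported.initialIdeal MonomialOrder.lex
        (TwoSupported.toricIdeal K r x :
          Set (MvPolynomial (TwoSupported.Var r x) K))) := by
  have hspec := fun g hg => TwoSupported.basis_spec (r := r) (x := x) K hr hx (g := g) hg
  obtain ⟨hsub, hini⟩ := TwoSupported.initialIdeal_eq_initialIdeal_ker MonomialOrder.lex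
    (TwoSupported.config r x) (G := TwoSupported.basis K r x)
    (fun g hg => by
      obtain ⟨s, t, h1, h2, -⟩ := hspec g hg
      exact ⟨s, t, h1, h2.lt, h2.weight_eq⟩)
    (fun s t hs ht h => (TwoSupported.isStandard_of_not_degree_le K hr hx hs).eq_of_weight_eq
      (TwoSupported.isStandard_of_not_degree_le K hr hx ht) h)
  refine ⟨⟨TwoSupported.basis_finite K, hsub, hini⟩, fun g hg => ?_,
    MonomialOrder.lex.degree '' TwoSupported.basis K r x, ?_, ?_⟩
  · obtain ⟨s, t, rfl, h2, h3⟩ := hspec g hg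
    exact ⟨TwoSupported.monomial_sub_monomial_ne_zero h2.lt,
      (TwoSupported.degree_monomial_sub_monomial (K := K) h2.lt).symm ▸ h3⟩
  · rintro _ ⟨g, hg, rfl⟩
    obtain ⟨s, t, rfl, h2, h3⟩ := hspec g hg
    exact (TwoSupported.degree_monomial_sub_monomial (K := K) h2.lt).symm ▸ h3
  · refine hini.symm.trans ?_
    rw [TwoSupported.initialIdeal, Set.image_image]
    congr 1
    refine Set.image_congr fun g hg => ?_
    obtain ⟨s, t, rfl, h2, -⟩ := hspec g hg
    rw [TwoSupported.leadingTerm_monomial_sub_monomial h2.lt,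
      TwoSupported.degree_monomial_sub_monomial h2.lt]
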